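/- Let $p$ be a prime, $k$ a field of characteristic $p$, and $A=k[x_1,\dots,x_n]$ ($n\ge 0$) the polynomial ring, graded by $\deg(x_i)=-1$. A $p$-DG $A$-module is a $\mathbb Z$-graded $A$-module $M$ with an $A$-linear map $d\colon M\to M$ of degree $-1$ such that $d^p=0$; it is called free if its underlying graded $A$-module is a direct sum of shifts of $A$, and finitely generated if its underlying $A$-module is. For a ring $R$ and an $R$-module $P$ with an $R$-linear map $d\colon P\to P$ such that $d^p=0$ (a $p$-differential $R$-module), put ${}_sH(P)=\ker(d^s)/\operatorname{im}(d^{p-s})$ for $1\le s\le p-1$, and call $P$ contractible if it is isomorphic, as an $R$-module with differential, to a direct sum $C\oplus\dots\oplus C$ of $p$ copies of some $R$-module $C$ with differential $(c_1,\dots,c_p)\mapsto(c_2,\dots,c_p,0)$. Let $M$ be a finitely generated free $p$-DG $A$-module such that $\dim_k {}_sH(M)<\infty$ for all $1\le s\le p-1$, and let $\mathfrak m\ne(x_1,\dots,x_n)$ be a maximal ideal of $A$, not necessarily homogeneous. Equip $M\otimes_A A/\mathfrak m$ and $M\otimes_A A_{\mathfrak m}$ with the differentials induced by $d$. Then $${}_sH(M\otimes_A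 A/\mathfrak m)=0\quad\text{for all } 1\le s\le p-1,$$ and the $p$-differential $A_{\mathfrak m}$-module $M\otimes_A A_{\mathfrak m}$ is contractible. -/

import Mathlib

open scoped TensorProduct

universe u v

/-- The degree `i` part of `k[x₁, …, xₙ]`, graded over `ℤ` by `deg xⱼ = -1`. -/
noncomputable def polyGrading (k : Type u) [Field k] (n : ℕ) (i : ℤ) :
    Submodule k (MvPolynomial (Fin n) k) :=
  MvPolynomial.weightedHomogeneousSubmodule k (fun _ : Fin n => (-1 : ℤ)) i

/-- A `p`-differential graded module over `A = k[x₁, …, xₙ]` with underlying ungraded `A`-module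
`M`: a `ℤ`-grading `gr` of `M` making it a graded `A`-module, and an `A`-linear map `d` of
degree `-1` with `d ^ p = 0`. -/
structure PDGModule (k : Type u) [Field k] (n p : ℕ) (M : Type v) [AddCommGroup M] [Module k M]
    [Module (MvPolynomial (Fin n) k) M] [IsScalarTower k (MvPolynomial (Fin n) k) M] where
  gr : ℤ → Submodule k M
  isInternal : DirectSum.IsInternal gr
  smul_mem : ∀ (i j : ℤ) (a : MvPolynomial (Fin n) k) (x : M),
    a ∈ polyGrading k n i → x ∈ gr j → a • x ∈ gr (i + j)
  d : M →ₗ[MvPolynomial (Fin n) k] M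
  d_mem : ∀ (i : ℤ) (x : M), x ∈ gr i → d x ∈ gr (i - 1)
  d_pow : d ^ p = 0

/-- A `p`-DG module is free if its underlying graded module is a direct sum of shifts of `A`,
that is, if it has an `A`-basis consisting of homogeneous elements. -/
def PDGModule.IsFree {k : Type u} [Field k] {n p : ℕ} {M : Type v} [AddCommGroup M] [Module k M]
    [Module (MvPolynomial (Fin n) k) M] [IsScalarTower k (MvPolynomial (Fin n) k) M]
    (D : PDGModule k n p M) : Prop :=
  ∃ (ι : Type v) (b : Module.Basis ι (MvPolynomial (Fin n) k) M) (c : ι → ℤ),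
    ∀ i, b i ∈ D.gr (c i)

/-- The homology `ₛH(P) = ker dˢ / im dᴺ⁻ˢ` of an `N`-differential module `(P, d)`, for
`1 ≤ s ≤ N - 1` and `d ^ N = 0`. (For a `p`-DG module this is the total homology, the direct sum of
all the homogeneous parts of the graded module `ₛH_•`.) -/
abbrev NHomology {R : Type u} [Ring R] {P : Type v} [AddCommGroup P] [Module R P]
    (N s : ℕ) (d : P →ₗ[R] P) : Type v :=
  LinearMap.ker (d ^ s) ⧸ (LinearMap.range (d ^ (N - s))).submoduleOf (LinearMap.ker (d ^ s))

/-- An `N`-differential module `(P, d)` is contractible if it is isomorphic to a direct sum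
`C ⊕ ⋯ ⊕ C` of `N` copies of a module `C`, with the differential
`(c₁, …, c_N) ↦ (c₂, …, c_N, 0)`. -/
def IsContractibleNDifferential {R : Type u} [Ring R] {P : Type v} [AddCommGroup P] [Module R P]
    (N : ℕ) (d : P →ₗ[R] P) : Prop :=
  ∃ (C : Type v) (_ : AddCommGroup C) (_ : Module R C) (e : P ≃ₗ[R] (Fin N → C)),
    ∀ (x : P) (i : Fin N), e (d x) i = if h : (i : ℕ) + 1 < N then e x ⟨i + 1, h⟩ else 0

/-!
Multiplication by a variable `X j` shifts degrees by `-1`, so it acts nilpotently on each finite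
dimensional homology `ₛH(M)`. Some `X j` lies outside `m`; it becomes a unit in `A_m`, and since
localization is exact, `M ⊗ A_m` is a projective `N`-differential module without homology. Thus
`im d = ker dᴺ⁻¹` is an arbitrarily high syzygy of the 2-periodic exact sequence with maps `d` and
`dᴺ⁻¹`, hence projective because `A_m` has finite global dimension. So `ker d` has a retraction `ρ`,
and `x ↦ (ρ x, ρ (d x), …, ρ (dᴺ⁻¹ x))` is an isomorphism onto `N` copies of `ker d` that exhibits
contractibility. Contractibility passes along the base change `A_m → A/m`, and a contractible
module has no homology.
-/

section ProjectiveDimension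

open CategoryTheory

theorem hasProjectiveDimensionLE_of_exact {R : Type u} [Ring R] {L M N : Type v}
    [AddCommGroup L] [Module R L] [AddCommGroup M] [Module R M] [AddCommGroup N] [Module R N]
    {f : L →ₗ[R] M} {g : M →ₗ[R] N} (hf : Function.Injective f) (hfg : Function.Exact f g)
    (hg : Function.Surjective g) {n : ℕ} (hL : HasProjectiveDimensionLE (ModuleCat.of R L) n)
    (hM : HasProjectiveDimensionLE (ModuleCat.of R M) (n + 1)) :
    HasProjectiveDimensionLE (ModuleCat.of R N) (n + 1) :=
  (ModuleCat.shortComplex_shortExact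
    (ShortComplex.mk (ModuleCat.ofHom f) (ModuleCat.ofHom g)
      (by ext x; exact hfg.apply_apply_eq_zero x)) hfg hf hg).hasProjectiveDimensionLT_X₃
    (n + 1) hL hM

theorem hasProjectiveDimensionLE_ker {R : Type u} [Ring R] [Small.{v} R] {M N : Type v}
    [AddCommGroup M] [Module R M] [AddCommGroup N] [Module R N] [Module.Projective R M]
    {g : M →ₗ[R] N} (hg : Function.Surjective g) {n : ℕ}
    (hN : HasProjectiveDimensionLE (ModuleCat.of R N) (n + 1)) :
    HasProjectiveDimensionLE (ModuleCat.of R (LinearMap.ker g)) n := by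
  have hM : Projective (ModuleCat.of R M) := (IsProjective.iff_projective M).mp ‹_›
  exact ((LinearMap.shortExact_shortComplexKer hg).hasProjectiveDimensionLT_X₃_iff n hM).mp hN

theorem hasProjectiveDimensionLE_ker_of_exact {R : Type u} [Ring R] [Small.{v} R] {L M N : Type v}
    [AddCommGroup L] [Module R L] [AddCommGroup M] [Module R M] [AddCommGroup N] [Module R N]
    [Module.Projective R L] {f : L →ₗ[R] M} {g : M →ₗ[R] N} (hfg : Function.Exact f g) {n : ℕ}
    (hg : HasProjectiveDimensionLE (ModuleCat.of R (LinearMap.ker g)) (n + 1)) :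
    HasProjectiveDimensionLE (ModuleCat.of R (LinearMap.ker f)) n := by
  rw [LinearMap.exact_iff] at hfg
  rw [hfg] at hg
  have := hasProjectiveDimensionLE_ker f.surjective_rangeRestrict hg
  rwa [LinearMap.ker_rangeRestrict] at this

theorem hasProjectiveDimensionLE_zero_iff {R : Type u} [Ring R] [Small.{v} R] {M : Type v}
    [AddCommGroup M] [Module R M] :
    HasProjectiveDimensionLE (ModuleCat.of R M) 0 ↔ Module.Projective R M := by
  rw [← projective_iff_hasProjectiveDimensionLE_zero, IsProjective.iff_projective]

theorem hasProjectiveDimensionLE_of_projective {R : Type u} [Ring R] [Small.{v} R] {M : Type v}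
    [AddCommGroup M] [Module R M] [Module.Projective R M] (n : ℕ) :
    HasProjectiveDimensionLE (ModuleCat.of R M) n :=
  have := hasProjectiveDimensionLE_zero_iff.mpr ‹Module.Projective R M›
  hasProjectiveDimensionLT_of_ge _ 1 _ (Nat.le_add_left 1 n)

theorem hasProjectiveDimensionLE_baseChange {R S : Type u} [CommRing R] [CommRing S] [Algebra R S]
    [Module.Flat R S] {M : Type (max u v)} [AddCommGroup M] [Module R M] {n : ℕ}
    (h : HasProjectiveDimensionLE (ModuleCat.of R M) n) :
    HasProjectiveDimensionLE (ModuleCat.of S (S ⊗[R] M)) n := by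
  induction n generalizing M with
  | zero =>
    rw [hasProjectiveDimensionLE_zero_iff] at h ⊢
    infer_instance
  | succ n ih =>
    obtain ⟨P, _, _, _, g, hg⟩ : ∃ (P : Type (max u v)) (_ : AddCommGroup P) (_ : Module R P)
        (_ : Module.Projective R P) (g : P →ₗ[R] M), Function.Surjective g :=
      ⟨M →₀ R, inferInstance, inferInstance, inferInstance, _,
        Finsupp.linearCombination_id_surjective R M⟩
    refine hasProjectiveDimensionLE_of_exact (f := (LinearMap.ker g).subtype.baseChange S)
      (g := g.baseChange S) ?_ ?_ ?_ (ih (hasProjectiveDimensionLE_ker hg h))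
      (hasProjectiveDimensionLE_of_projective _)
    · exact Module.Flat.lTensor_preserves_injective_linearMap _ Subtype.val_injective
    · exact lTensor_exact S (LinearMap.exact_subtype_ker_map g) hg
    · exact LinearMap.lTensor_surjective S hg

end ProjectiveDimension

section CharacteristicSequence

open Polynomial

variable {R : Type*} [CommRing R] {N : Type*} [AddCommGroup N] [Module R N]

theorem finsupp_nat_eq_zero_of_eq_map_succ {u : ℕ →₀ N} {φ : N →ₗ[R] N}
    (h : ∀ i, u i = φ (u (i + 1))) : u = 0 := by
  have vanish_of_le (j i : ℕ) (hij : u (i + j) = 0) : u i = 0 := by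
    induction j with
    | zero => exact hij
    | succ j ih => exact ih (by rw [h, add_assoc, hij, map_zero])
  obtain ⟨B, hB⟩ := u.support.bddAbove
  ext i
  refine vanish_of_le (B + 1) i (Finsupp.notMem_support_iff.mp fun hi => ?_)
  have := hB hi
  omega

variable [Module R[X] N] [IsScalarTower R R[X] N]

variable (R N) in
/-- The first map of the characteristic sequence `0 → R[X] ⊗ N → R[X] ⊗ N → N → 0` of an
`R[X]`-module `N`, namely `X ⊗ 1 - 1 ⊗ X`; the second one is multiplication. -/
noncomputable def characteristicMap : R[X] ⊗[R] N →ₗ[R[X]] R[X] ⊗[R] N :=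
  (X : R[X]) • LinearMap.id - (Algebra.lsmul R R N (X : R[X])).baseChange R[X]

theorem characteristicMap_tmul (q : R[X]) (y : N) :
    characteristicMap R N (q ⊗ₜ y) = (X * q) ⊗ₜ y - q ⊗ₜ ((X : R[X]) • y) := by
  simp [characteristicMap, TensorProduct.smul_tmul']

theorem characteristicMap_injective : Function.Injective (characteristicMap R N) := by
  let e := TensorProduct.equivFinsuppOfBasisLeft (N := N) (Polynomial.basisMonomials R)
  have coeff_tmul (q : R[X]) (y : N) (i : ℕ) : e (q ⊗ₜ y) i = q.coeff i • y :=
    TensorProduct.equivFinsuppOfBasisLeft_apply_tmul_apply ..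
  have coeff_succ (t : R[X] ⊗[R] N) (i : ℕ) :
      e (characteristicMap R N t) (i + 1) = e t i - (X : R[X]) • e t (i + 1) := by
    induction t with
    | zero => simp
    | add s t hs ht =>
      simp only [map_add, Finsupp.add_apply, hs, ht, smul_add]
      abel
    | tmul q y =>
      rw [characteristicMap_tmul, map_sub, Finsupp.sub_apply]
      simp only [coeff_tmul]
      rw [coeff_X_mul, smul_comm (X : R[X])]
  rw [injective_iff_map_eq_zero]
  intro t ht
  refine e.map_eq_zero_iff.mp (finsupp_nat_eq_zero_of_eq_map_succ
    (φ := Algebra.lsmul R R N (X : R[X])) fun i => sub_eq_zero.mp ?_)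
  rw [Algebra.lsmul_coe, ← coeff_succ, ht, map_zero, Finsupp.zero_apply]

theorem sub_one_tmul_mem_range_characteristicMap (t : R[X] ⊗[R] N) :
    t - 1 ⊗ₜ (LinearMap.liftBaseChange R[X] (LinearMap.id : N →ₗ[R] N) t) ∈
      LinearMap.range (characteristicMap R N) := by
  induction t with
  | zero => simp
  | add s t hs ht =>
    rw [map_add, TensorProduct.tmul_add, add_sub_add_comm]
    exact add_mem hs ht
  | tmul q y =>
    rw [LinearMap.liftBaseChange_tmul, LinearMap.id_apply]
    induction q using Polynomial.induction_on generalizing y with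
    | C a =>
      rw [← mul_one (C a), ← smul_eq_C_mul, TensorProduct.smul_tmul, smul_assoc, one_smul, sub_self]
      exact zero_mem _
    | add q r hq hr =>
      rw [TensorProduct.add_tmul, add_smul, TensorProduct.tmul_add, add_sub_add_comm]
      exact add_mem (hq y) (hr y)
    | monomial i a ih =>
      rw [← sub_add_sub_cancel _ ((C a * X ^ i) ⊗ₜ[R] ((X : R[X]) • y))]
      refine add_mem ⟨(C a * X ^ i) ⊗ₜ y, ?_⟩ ?_
      · rw [characteristicMap_tmul, pow_succ', mul_left_comm]
      · rw [pow_succ, ← mul_assoc, mul_smul]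
        exact ih ((X : R[X]) • y)

theorem characteristicMap_exact : Function.Exact (characteristicMap R N)
    (LinearMap.liftBaseChange R[X] (LinearMap.id : N →ₗ[R] N)) := by
  have comp_eq_zero : LinearMap.liftBaseChange R[X] (LinearMap.id : N →ₗ[R] N) ∘ₗ
      characteristicMap R N = 0 := by
    ext y
    simp [characteristicMap_tmul]
  intro t
  constructor
  · intro ht
    simpa [ht] using sub_one_tmul_mem_range_characteristicMap t
  · rintro ⟨t, rfl⟩
    exact LinearMap.congr_fun comp_eq_zero t

end CharacteristicSequence

section GlobalDimension

open CategoryTheory Polynomial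

theorem hasProjectiveDimensionLE_polynomial {R : Type u} [CommRing R] {N : Type (max u v)}
    [AddCommGroup N] [Module R N] [Module R[X] N] [IsScalarTower R R[X] N] {n : ℕ}
    (h : HasProjectiveDimensionLE (ModuleCat.of R N) n) :
    HasProjectiveDimensionLE (ModuleCat.of R[X] N) (n + 1) := by
  have hT := hasProjectiveDimensionLE_baseChange.{u, v} (S := R[X]) h
  have hmul : Function.Surjective (LinearMap.liftBaseChange R[X] (LinearMap.id : N →ₗ[R] N)) :=
    fun y => ⟨1 ⊗ₜ y, by simp⟩
  exact hasProjectiveDimensionLE_of_exact characteristicMap_injective characteristicMap_exact hmul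
    hT (hasProjectiveDimensionLT_of_ge _ (n + 1) _ n.succ.le_succ)

/-- The global dimension of `R` is at most `n`: every `R`-module has projective dimension at most
`n`. The modules range over one universe `max u v`, since Mathlib's `HasProjectiveDimensionLE`
depends on it. -/
def GlobalDimensionLE (R : Type u) [Ring R] (n : ℕ) : Prop :=
  ∀ (M : Type (max u v)) [AddCommGroup M] [Module R M],
    HasProjectiveDimensionLE (ModuleCat.of R M) n

theorem GlobalDimensionLE.isLocalization {R S : Type u} [CommRing R] [CommRing S] [Algebra R S]
    (W : Submonoid R) [IsLocalization W S] {n : ℕ} (h : GlobalDimensionLE.{u, v} R n) :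
    GlobalDimensionLE.{u, v} S n := by
  intro M _ _
  let _ : Module R M := Module.compHom M (algebraMap R S)
  have : IsScalarTower R S M := .of_algebraMap_smul fun _ _ => rfl
  have : Module.Flat R S := IsLocalization.flat S W
  have := hasProjectiveDimensionLE_baseChange.{u, v} (S := S) (h M)
  exact hasProjectiveDimensionLT_of_iso (IsLocalization.moduleLid W S M).toModuleIso (n + 1)

theorem GlobalDimensionLE.of_ringEquiv {R S : Type u} [CommRing R] [CommRing S] (e : R ≃+* S)
    {n : ℕ} (h : GlobalDimensionLE.{u, v} R n) : GlobalDimensionLE.{u, v} S n := by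
  let _ : Algebra R S := e.toRingHom.toAlgebra
  have : IsLocalization (⊥ : Submonoid R) R := IsLocalization.self bot_le
  have : IsLocalization (⊥ : Submonoid R) S :=
    IsLocalization.isLocalization_of_algEquiv ⊥ (AlgEquiv.ofRingEquiv (f := e) fun _ => rfl)
  exact h.isLocalization ⊥

theorem GlobalDimensionLE.polynomial {R : Type u} [CommRing R] {n : ℕ}
    (h : GlobalDimensionLE.{u, v} R n) : GlobalDimensionLE.{u, v} R[X] (n + 1) := by
  intro N _ _
  let _ : Module R N := Module.compHom N (algebraMap R R[X])
  have : IsScalarTower R R[X] N := .of_algebraMap_smul fun _ _ => rfl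
  exact hasProjectiveDimensionLE_polynomial.{u, v} (h N)

theorem globalDimensionLE_zero_of_field (k : Type u) [Field k] : GlobalDimensionLE.{u, v} k 0 :=
  fun _ _ _ => hasProjectiveDimensionLE_of_projective 0

theorem globalDimensionLE_mvPolynomial (k : Type u) [Field k] (n : ℕ) :
    GlobalDimensionLE.{u, v} (MvPolynomial (Fin n) k) n := by
  induction n with
  | zero =>
    exact GlobalDimensionLE.of_ringEquiv.{u, v} (MvPolynomial.isEmptyRingEquiv k (Fin 0)).symm
      (globalDimensionLE_zero_of_field k)
  | succ n ih =>
    exact GlobalDimensionLE.of_ringEquiv.{u, v} (MvPolynomial.finSuccEquiv k n).symm.toRingEquiv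
      ih.polynomial

theorem projective_ker_of_exact {R : Type u} [Ring R] {P Q : Type (max u v)} [AddCommGroup P]
    [Module R P] [Module.Projective R P] [AddCommGroup Q] [Module R Q] [Module.Projective R Q]
    {f : P →ₗ[R] Q} {g : Q →ₗ[R] P} (hfg : Function.Exact f g) (hgf : Function.Exact g f) {n : ℕ}
    (hR : GlobalDimensionLE.{u, v} R n) : Module.Projective R (LinearMap.ker f) := by
  have descend (m : ℕ)
      (hf : HasProjectiveDimensionLE (ModuleCat.of R (LinearMap.ker f)) m)
      (hg : HasProjectiveDimensionLE (ModuleCat.of R (LinearMap.ker g)) m) :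
      HasProjectiveDimensionLE (ModuleCat.of R (LinearMap.ker f)) 0 := by
    induction m with
    | zero => exact hf
    | succ m ih =>
      exact ih (hasProjectiveDimensionLE_ker_of_exact hfg hg)
        (hasProjectiveDimensionLE_ker_of_exact hgf hf)
  exact hasProjectiveDimensionLE_zero_iff.mp (descend n (hR _) (hR _))

end GlobalDimension

section NDifferential

variable {R : Type*} [Ring R] {P : Type*} [AddCommGroup P] [Module R P]

theorem exists_retraction_ker {Q : Type*} [AddCommGroup Q] [Module R Q] (f : P →ₗ[R] Q)
    [Module.Projective R (LinearMap.range f)] :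
    ∃ ρ : P →ₗ[R] LinearMap.ker f, ρ ∘ₗ (LinearMap.ker f).subtype = LinearMap.id := by
  have hexact : Function.Exact (LinearMap.ker f).subtype f.rangeRestrict := by
    rw [LinearMap.exact_iff, LinearMap.ker_rangeRestrict, Submodule.range_subtype]
  exact ((hexact.split_tfae Subtype.val_injective f.surjective_rangeRestrict).out 0 1).mp
    (Module.projective_lifting_property _ LinearMap.id f.surjective_rangeRestrict)

variable {d : P →ₗ[R] P} {ρ : P →ₗ[R] LinearMap.ker d}

theorem retraction_pow_injective {N : ℕ} (hd : d ^ N = 0)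
    (hρ : ρ ∘ₗ (LinearMap.ker d).subtype = LinearMap.id) :
    Function.Injective (LinearMap.pi fun i : Fin N => ρ ∘ₗ d ^ (i : ℕ)) := by
  rw [injective_iff_map_eq_zero]
  intro x hx
  suffices (d ^ 0) x = 0 by simpa
  refine Nat.decreasingInduction (motive := fun s _ => (d ^ s) x = 0) (fun s hs ih => ?_)
    (LinearMap.congr_fun hd x) N.zero_le
  have hker : (d ^ s) x ∈ LinearMap.ker d := by
    rwa [LinearMap.mem_ker, ← Module.End.mul_apply, ← pow_succ']
  have hfix : ρ ((d ^ s) x) = ⟨(d ^ s) x, hker⟩ := LinearMap.congr_fun hρ ⟨_, hker⟩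
  exact congrArg Subtype.val (hfix.symm.trans (congrFun hx ⟨s, hs⟩))

theorem retraction_pow_surjective {q : ℕ} (hq : LinearMap.ker d ≤ LinearMap.range (d ^ q))
    (hρ : ρ ∘ₗ (LinearMap.ker d).subtype = LinearMap.id) :
    Function.Surjective (LinearMap.pi fun i : Fin (q + 1) => ρ ∘ₗ d ^ (i : ℕ)) := by
  set φ := LinearMap.pi fun i : Fin (q + 1) => ρ ∘ₗ d ^ (i : ℕ) with hφ
  suffices mem_range : ∀ s ≤ q + 1, ∀ c : Fin (q + 1) → LinearMap.ker d,
      (∀ i : Fin (q + 1), s ≤ i → c i = 0) → c ∈ LinearMap.range φ from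
    fun c => mem_range (q + 1) le_rfl c fun i hi => absurd i.2 hi.not_gt
  intro s hs c hc
  induction s generalizing c with
  | zero => exact ⟨0, by rw [map_zero, funext fun i => hc i i.val.zero_le, Pi.zero_def]⟩
  | succ s ih =>
    -- If `dᵠ y = c s`, then `dᵠ⁻ˢ y` accounts for the last nonzero coordinate `s` of `c`.
    obtain ⟨y, hy⟩ := hq (c ⟨s, hs⟩).2
    have lift_apply (i : Fin (q + 1)) (t : ℕ) (hi : (i : ℕ) = s + t) :
        φ ((d ^ (q - s)) y) i = ρ ((d ^ t) (c ⟨s, hs⟩)) := by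
      rw [← hy, hφ, LinearMap.pi_apply, LinearMap.comp_apply, ← Module.End.mul_apply,
        ← Module.End.mul_apply, ← pow_add, ← pow_add, show (i : ℕ) + (q - s) = t + q by omega]
    have hsub : c - φ ((d ^ (q - s)) y) ∈ LinearMap.range φ := by
      refine ih (by omega) _ fun i hi => sub_eq_zero.mpr ?_
      obtain ⟨_ | t, ht⟩ := Nat.exists_eq_add_of_le hi
      · obtain rfl : i = ⟨s, hs⟩ := Fin.ext ht
        rw [lift_apply _ 0 rfl]
        exact (LinearMap.congr_fun hρ _).symm
      · rw [lift_apply i _ ht, hc i (by omega), pow_succ, Module.End.mul_apply,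
          LinearMap.map_coe_ker, map_zero, map_zero]
    simpa using add_mem hsub (LinearMap.mem_range_self φ ((d ^ (q - s)) y))

theorem isContractibleNDifferential_of_projective_range [Module.Projective R (LinearMap.range d)]
    {q : ℕ} (hd : d ^ (q + 1) = 0) (hq : LinearMap.ker d ≤ LinearMap.range (d ^ q)) :
    IsContractibleNDifferential (q + 1) d := by
  obtain ⟨ρ, hρ⟩ := exists_retraction_ker d
  have hbij : Function.Bijective (LinearMap.pi fun i : Fin (q + 1) => ρ ∘ₗ d ^ (i : ℕ)) :=
    ⟨retraction_pow_injective hd hρ, retraction_pow_surjective hq hρ⟩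
  refine ⟨LinearMap.ker d, inferInstance, inferInstance, LinearEquiv.ofBijective _ hbij,
    fun x i => ?_⟩
  simp only [LinearEquiv.ofBijective_apply, LinearMap.pi_apply, LinearMap.comp_apply]
  rw [← Module.End.mul_apply, ← pow_succ]
  split_ifs with hi
  · rfl
  · rw [show (i : ℕ) + 1 = q + 1 by omega, hd, LinearMap.zero_apply, map_zero]

theorem isContractibleNDifferential_of_globalDimensionLE {R : Type u} [Ring R]
    {P : Type (max u v)} [AddCommGroup P] [Module R P] [Module.Projective R P] {n q : ℕ}
    (hR : GlobalDimensionLE.{u, v} R n) {d : P →ₗ[R] P} (hd : d ^ (q + 1) = 0)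
    (hq : LinearMap.ker d ≤ LinearMap.range (d ^ q))
    (hq' : LinearMap.ker (d ^ q) ≤ LinearMap.range d) :
    IsContractibleNDifferential (q + 1) d := by
  have hker : LinearMap.ker (d ^ q) = LinearMap.range d :=
    hq'.antisymm (LinearMap.range_le_ker_iff.mpr ((pow_succ d q).symm.trans hd))
  have hker' : LinearMap.ker d = LinearMap.range (d ^ q) :=
    hq.antisymm (LinearMap.range_le_ker_iff.mpr ((pow_succ' d q).symm.trans hd))
  have hproj := projective_ker_of_exact (LinearMap.exact_iff.mpr hker')
    (LinearMap.exact_iff.mpr hker) hR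
  rw [hker] at hproj
  exact isContractibleNDifferential_of_projective_range hd hq

end NDifferential

section Contractible

theorem pow_apply_of_shift {R : Type*} [Ring R] {P C : Type*} [AddCommGroup P] [Module R P]
    [AddCommGroup C] [Module R C] {N : ℕ} {d : P →ₗ[R] P} {e : P ≃ₗ[R] (Fin N → C)}
    (he : ∀ x (i : Fin N), e (d x) i = if h : (i : ℕ) + 1 < N then e x ⟨i + 1, h⟩ else 0)
    (t : ℕ) (x : P) (i : Fin N) :
    e ((d ^ t) x) i = if h : (i : ℕ) + t < N then e x ⟨i + t, h⟩ else 0 := by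
  induction t generalizing x with
  | zero => simp
  | succ t ih =>
    rw [pow_succ, Module.End.mul_apply, ih]
    split_ifs with ht hts hts
    · simp only [he, add_assoc, dif_pos hts]
    · simp only [he, add_assoc, dif_neg hts]
    · omega
    · rfl

namespace IsContractibleNDifferential

theorem ker_pow_le_range_pow {R : Type*} [Ring R] {P : Type*} [AddCommGroup P] [Module R P]
    {N : ℕ} {d : P →ₗ[R] P} (h : IsContractibleNDifferential N d) {s : ℕ} (hs : s ≤ N) :
    LinearMap.ker (d ^ s) ≤ LinearMap.range (d ^ (N - s)) := by
  obtain ⟨C, _, _, e, he⟩ := h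
  intro x hx
  have coord_eq_zero (i : Fin N) (hi : s ≤ i) : e x i = 0 := by
    have := pow_apply_of_shift he s x ⟨i - s, by omega⟩
    simpa only [LinearMap.mem_ker.mp hx, map_zero, Pi.zero_apply, Nat.sub_add_cancel hi, i.2,
      dite_true, eq_comm] using this
  refine ⟨e.symm fun i => if N - s ≤ i then e x ⟨i - (N - s), by omega⟩ else 0,
    e.injective (funext fun i => ?_)⟩
  rw [pow_apply_of_shift he, e.apply_symm_apply]
  by_cases hi : (i : ℕ) < s
  · simp [show (i : ℕ) + (N - s) < N by omega]
  · rw [dif_neg (by omega), coord_eq_zero i (by omega)]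

theorem subsingleton_NHomology {R : Type*} [Ring R] {P : Type*} [AddCommGroup P] [Module R P]
    {N : ℕ} {d : P →ₗ[R] P} (h : IsContractibleNDifferential N d) {s : ℕ} (hs : s ≤ N) :
    Subsingleton (NHomology N s d) :=
  Submodule.Quotient.subsingleton_iff.mpr
    (Submodule.submoduleOf_eq_top.mpr (h.ker_pow_le_range_pow hs))

theorem of_linearEquiv {R : Type*} [Ring R] {P Q : Type v} [AddCommGroup P] [Module R P]
    [AddCommGroup Q] [Module R Q] {N : ℕ} {d : P →ₗ[R] P} {d' : Q →ₗ[R] Q}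
    (h : IsContractibleNDifferential N d) (e : Q ≃ₗ[R] P) (he : ∀ y, e (d' y) = d (e y)) :
    IsContractibleNDifferential N d' := by
  obtain ⟨C, _, _, f, hf⟩ := h
  exact ⟨C, _, _, e.trans f, fun y i => by simp only [LinearEquiv.trans_apply, he, hf]⟩

theorem baseChange {R S : Type u} [CommRing R] [CommRing S] [Algebra R S] {P : Type (max u v)}
    [AddCommGroup P] [Module R P] {N : ℕ} {d : P →ₗ[R] P} (h : IsContractibleNDifferential N d) :
    IsContractibleNDifferential N (d.baseChange S) := by
  obtain ⟨C, _, _, e, he⟩ := h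
  refine ⟨S ⊗[R] C, inferInstance, inferInstance,
    (e.baseChange R S _ _).trans (TensorProduct.piRight R S S fun _ : Fin N => C), fun z i => ?_⟩
  induction z with
  | zero => simp
  | add y z hy hz =>
    rw [map_add, map_add, Pi.add_apply, hy, hz]
    split_ifs <;> simp
  | tmul a x =>
    simp only [LinearMap.baseChange_tmul, LinearEquiv.trans_apply, LinearEquiv.baseChange_tmul,
      TensorProduct.piRight_apply, TensorProduct.piRightHom_tmul, he]
    split_ifs <;> simp

theorem baseChange_of_isScalarTower {A R S : Type u} [CommRing A] [CommRing R] [CommRing S]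
    [Algebra A R] [Algebra A S] [Algebra R S] [IsScalarTower A R S] {M : Type v} [AddCommGroup M]
    [Module A M] {N : ℕ} {d : M →ₗ[A] M}
    (h : IsContractibleNDifferential (P := R ⊗[A] M) N (d.baseChange R)) :
    IsContractibleNDifferential (P := S ⊗[A] M) N (d.baseChange S) := by
  let e := TensorProduct.AlgebraTensorModule.cancelBaseChange A R S S M
  refine (h.baseChange (S := S)).of_linearEquiv e.symm fun z => ?_
  induction z with
  | zero => simp
  | add y z hy hz => simp only [map_add, hy, hz]
  | tmul a x => simp [e]

theorem baseChange_quotient_of_localization {A : Type u} [CommRing A] {M : Type v}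
    [AddCommGroup M] [Module A M] {N : ℕ} {d : M →ₗ[A] M} (m : Ideal A) [m.IsMaximal]
    (h : IsContractibleNDifferential (P := Localization.AtPrime m ⊗[A] M) N
      (d.baseChange (Localization.AtPrime m))) :
    IsContractibleNDifferential (P := (A ⧸ m) ⊗[A] M) N (d.baseChange (A ⧸ m)) := by
  let _ := Ideal.Quotient.field m
  have isUnit_mk (y : m.primeCompl) : IsUnit (algebraMap A (A ⧸ m) y) :=
    isUnit_iff_ne_zero.mpr fun hy => y.2 (Ideal.Quotient.eq_zero_iff_mem.mp hy)
  let _ : Algebra (Localization.AtPrime m) (A ⧸ m) := (IsLocalization.lift isUnit_mk).toAlgebra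
  have : IsScalarTower A (Localization.AtPrime m) (A ⧸ m) :=
    .of_algebraMap_eq fun a => (IsLocalization.lift_eq isUnit_mk a).symm
  exact h.baseChange_of_isScalarTower

end IsContractibleNDifferential

end Contractible

section Graded

variable {ι k M : Type*} [Field k] [AddCommGroup M] [Module k M]
  {gr : ι → Submodule k M}

/-- The linear map `f` is homogeneous of degree `e`: it maps the degree `i` part of `gr` into the
degree `i + e` part, for every `i`. -/
def ShiftsDegree [Add ι] (gr : ι → Submodule k M) (e : ι) (f : M →ₗ[k] M) : Prop :=
  ∀ ⦃i x⦄, x ∈ gr i → f x ∈ gr (i + e)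

namespace ShiftsDegree

variable {e : ι} {f : M →ₗ[k] M}

theorem pow [AddMonoid ι] (hf : ShiftsDegree gr e f) (t : ℕ) :
    ShiftsDegree gr (t • e) (f ^ t) := by
  intro i x hx
  induction t with
  | zero => simpa using hx
  | succ t ih =>
    rw [pow_succ', Module.End.mul_apply, succ_nsmul, ← add_assoc]
    exact hf ih

variable [DecidableEq ι] [AddGroup ι] [DirectSum.Decomposition gr]

theorem decompose_apply (hf : ShiftsDegree gr e f) (x : M) (i : ι) :
    (DirectSum.decompose gr (f x) (i + e) : M) = f (DirectSum.decompose gr x i) := by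
  induction x using DirectSum.Decomposition.inductionOn gr with
  | zero => simp
  | @homogeneous j y =>
    by_cases hji : j = i
    · subst hji
      rw [DirectSum.decompose_of_mem_same _ (hf y.2), DirectSum.decompose_of_mem_same _ y.2]
    · rw [DirectSum.decompose_of_mem_ne _ (hf y.2) (by simpa using hji),
        DirectSum.decompose_of_mem_ne _ y.2 hji, map_zero]
  | add a b ha hb => simp [ha, hb]

theorem isHomogeneous_ker (hf : ShiftsDegree gr e f) : (LinearMap.ker f).IsHomogeneous gr := by
  intro i x hx
  rw [LinearMap.mem_ker, ← hf.decompose_apply, LinearMap.mem_ker.mp hx, DirectSum.decompose_zero,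
    DirectSum.zero_apply, ZeroMemClass.coe_zero]

theorem isHomogeneous_range (hf : ShiftsDegree gr e f) : (LinearMap.range f).IsHomogeneous gr := by
  rintro i _ ⟨x, rfl⟩
  exact ⟨DirectSum.decompose gr x (i - e), by rw [← hf.decompose_apply, sub_add_cancel]⟩

end ShiftsDegree

theorem finite_setOf_not_inf_le [DecidableEq ι] [DirectSum.Decomposition gr] {K W : Submodule k M}
    (hW : W.IsHomogeneous gr) [FiniteDimensional k (K ⧸ W.submoduleOf K)] :
    {i | ¬ gr i ⊓ K ≤ W}.Finite := by
  have exists_rep (i : {i | ¬ gr i ⊓ K ≤ W}) : ∃ x : K, (x : M) ∈ gr i ∧ (x : M) ∉ W := by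
    obtain ⟨x, hx, hxW⟩ := SetLike.not_le_iff_exists.mp i.2
    exact ⟨⟨x, hx.2⟩, hx.1, hxW⟩
  choose v hv hvW using exists_rep
  suffices LinearIndependent k fun i => (W.submoduleOf K).mkQ (v i) from
    Set.finite_coe_iff.mp this.finite_of_isNoetherian
  rw [linearIndependent_iff']
  intro s c hc i hi
  have hsum : ∑ j ∈ s, c j • (v j : M) ∈ W := by
    simp_rw [← map_smul, ← map_sum] at hc
    rw [Submodule.mkQ_apply, Submodule.Quotient.mk_eq_zero] at hc
    simpa using show ((∑ j ∈ s, c j • v j : K) : M) ∈ W from hc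
  have hcomponent :
      (DirectSum.decompose gr (∑ j ∈ s, c j • (v j : M)) i : M) = c i • (v i : M) := by
    rw [DirectSum.decompose_sum, DirectSum.sum_apply, AddSubmonoidClass.coe_finsetSum,
      Finset.sum_eq_single_of_mem i hi fun j _ hj => DirectSum.decompose_of_mem_ne _
        (Submodule.smul_mem _ _ (hv j)) (Subtype.coe_injective.ne hj),
      DirectSum.decompose_of_mem_same _ (Submodule.smul_mem _ _ (hv i))]
  by_contra hci
  exact hvW i ((W.smul_mem_iff hci).mp (hcomponent ▸ hW i hsum))

theorem ShiftsDegree.exists_pow_apply_mem [DecidableEq ι] [AddGroup ι]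
    [DirectSum.Decomposition gr] {e : ι} (he : ¬ IsOfFinAddOrder e) {f : M →ₗ[k] M}
    (hf : ShiftsDegree gr e f) {K W : Submodule k M} (hK : K.IsHomogeneous gr)
    (hW : W.IsHomogeneous gr) (hfK : ∀ x ∈ K, f x ∈ K) (hfW : ∀ x ∈ W, f x ∈ W)
    [FiniteDimensional k (K ⧸ W.submoduleOf K)] :
    ∃ D : ℕ, ∀ x ∈ K, (f ^ D) x ∈ W := by
  classical
  let I := (finite_setOf_not_inf_le (K := K) hW).toFinset
  have pow_apply_mem_of_homogeneous {i : ι} {x : M} (hxi : x ∈ gr i) (hxK : x ∈ K) :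
      (f ^ I.card) x ∈ W := by
    by_contra hx
    have degree_mem (t : ℕ) (ht : t ∈ Finset.range (I.card + 1)) : i + t • e ∈ I := by
      rw [Set.Finite.mem_toFinset]
      refine fun hle => hx ?_
      have hxt := hle ⟨hf.pow t hxi, Module.End.pow_apply_mem_of_forall_mem t hfK x hxK⟩
      rw [← Nat.sub_add_cancel (Finset.mem_range_succ_iff.mp ht), pow_add, Module.End.mul_apply]
      exact Module.End.pow_apply_mem_of_forall_mem _ hfW _ hxt
    have degree_injective : Function.Injective fun t : ℕ => i + t • e :=
      (add_right_injective i).comp (injective_nsmul_iff_not_isOfFinAddOrder.mpr he)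
    have := Finset.card_le_card_of_injOn _ degree_mem degree_injective.injOn
    simp only [Finset.card_range] at this
    omega
  refine ⟨I.card, fun x hx => ?_⟩
  rw [← DirectSum.sum_support_decompose gr x, map_sum]
  exact W.sum_mem fun i _ => pow_apply_mem_of_homogeneous (SetLike.coe_mem _) (hK i hx)

end Graded

theorem ker_baseChange_le_range_baseChange {A S M N P : Type*} [CommRing A] [CommRing S]
    [Algebra A S] [Module.Flat A S] [AddCommGroup M] [Module A M] [AddCommGroup N] [Module A N]
    [AddCommGroup P] [Module A P] {f : M →ₗ[A] N} {g : P →ₗ[A] M} {c : A}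
    (hc : IsUnit (algebraMap A S c)) (h : ∀ x ∈ LinearMap.ker f, c • x ∈ LinearMap.range g) :
    LinearMap.ker (f.baseChange S) ≤ LinearMap.range (g.baseChange S) := by
  intro z hz
  obtain ⟨w, rfl⟩ := (Module.Flat.lTensor_exact S (LinearMap.exact_subtype_ker_map f) z).mp hz
  clear hz
  suffices algebraMap A S c • (LinearMap.ker f).subtype.baseChange S w ∈
      LinearMap.range (g.baseChange S) from
    (Submodule.smul_mem_iff_of_isUnit _ hc).mp this
  induction w with
  | zero => simp
  | add y w hy hw =>
    rw [map_add, smul_add]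
    exact add_mem hy hw
  | tmul a x =>
    obtain ⟨y, hy⟩ := h x x.2
    refine ⟨a ⊗ₜ y, ?_⟩
    rw [LinearMap.baseChange_tmul, hy, LinearMap.baseChange_tmul, algebraMap_smul,
      TensorProduct.tmul_smul, Submodule.subtype_apply]

theorem ker_constantCoeff_eq_idealOfVars (σ R : Type*) [CommRing R] :
    RingHom.ker (MvPolynomial.constantCoeff (R := R) (σ := σ)) = MvPolynomial.idealOfVars σ R := by
  ext f
  rw [← pow_one (MvPolynomial.idealOfVars σ R), MvPolynomial.mem_pow_idealOfVars_iff']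
  simp [Finsupp.degree_eq_zero_iff, MvPolynomial.constantCoeff_eq]

theorem exists_X_notMem {k σ : Type*} [Field k] {m : Ideal (MvPolynomial σ k)} [hm : m.IsMaximal]
    (hne : m ≠ MvPolynomial.idealOfVars σ k) : ∃ j, MvPolynomial.X j ∉ m := by
  contrapose! hne
  have hmax : (MvPolynomial.idealOfVars σ k).IsMaximal :=
    ker_constantCoeff_eq_idealOfVars σ k ▸
      RingHom.ker_isMaximal_of_surjective _ fun c => ⟨.C c, MvPolynomial.constantCoeff_C σ c⟩
  exact (hmax.eq_of_le hm.ne_top (Ideal.span_le.mpr (Set.range_subset_iff.mpr hne))).symm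

namespace PDGModule

variable {k : Type u} [Field k] {n N : ℕ} {M : Type v} [AddCommGroup M] [Module k M]
  [Module (MvPolynomial (Fin n) k) M] [IsScalarTower k (MvPolynomial (Fin n) k) M]
  {D : PDGModule k n N M}

theorem IsFree.projective (h : D.IsFree) : Module.Projective (MvPolynomial (Fin n) k) M := by
  obtain ⟨_, b, -⟩ := h
  exact .of_basis b

variable (D)

theorem shiftsDegree_d : ShiftsDegree D.gr (-1) (D.d.restrictScalars k) :=
  D.d_mem

theorem shiftsDegree_X (j : Fin n) :
    ShiftsDegree D.gr (-1) (Algebra.lsmul k k M (MvPolynomial.X j : MvPolynomial (Fin n) k)) := by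
  intro i x hx
  rw [add_comm]
  exact D.smul_mem (-1) i _ x (MvPolynomial.isWeightedHomogeneous_X k _ j) hx

theorem exists_X_pow_smul_mem_range (j : Fin n) (s : ℕ)
    (hs : FiniteDimensional k (NHomology N s D.d)) :
    ∃ t : ℕ, ∀ x ∈ LinearMap.ker (D.d ^ s),
      (MvPolynomial.X j ^ t : MvPolynomial (Fin n) k) • x ∈ LinearMap.range (D.d ^ (N - s)) := by
  let _ := D.isInternal.chooseDecomposition
  have restrictScalars_pow (t : ℕ) : (D.d ^ t).restrictScalars k = D.d.restrictScalars k ^ t := by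
    ext x
    simp [Module.End.pow_apply]
  have hpow (t : ℕ) : ShiftsDegree D.gr (t • (-1)) ((D.d ^ t).restrictScalars k) :=
    restrictScalars_pow t ▸ D.shiftsDegree_d.pow t
  have : FiniteDimensional k (LinearMap.ker ((D.d ^ s).restrictScalars k) ⧸
      (LinearMap.range ((D.d ^ (N - s)).restrictScalars k)).submoduleOf
        (LinearMap.ker ((D.d ^ s).restrictScalars k))) :=
    Module.Finite.equiv (Submodule.Quotient.restrictScalarsEquiv k
      ((LinearMap.range (D.d ^ (N - s))).submoduleOf (LinearMap.ker (D.d ^ s)))).symm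
  obtain ⟨t, ht⟩ := (D.shiftsDegree_X j).exists_pow_apply_mem
    (not_isOfFinAddOrder_of_isAddTorsionFree (by decide)) (hpow s).isHomogeneous_ker
    (hpow (N - s)).isHomogeneous_range
    (fun x hx => (LinearMap.ker (D.d ^ s)).smul_mem _ hx)
    (fun x hx => (LinearMap.range (D.d ^ (N - s))).smul_mem _ hx)
  exact ⟨t, fun x hx => by simpa [← map_pow] using ht x hx⟩

theorem ker_baseChange_pow_le_range {j : Fin n} {m : Ideal (MvPolynomial (Fin n) k)} [m.IsPrime]
    (hj : MvPolynomial.X j ∉ m) {s : ℕ} (hs : FiniteDimensional k (NHomology N s D.d)) :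
    LinearMap.ker (D.d.baseChange (Localization.AtPrime m) ^ s) ≤
      LinearMap.range (D.d.baseChange (Localization.AtPrime m) ^ (N - s)) := by
  obtain ⟨t, ht⟩ := D.exists_X_pow_smul_mem_range j s hs
  rw [← LinearMap.baseChange_pow, ← LinearMap.baseChange_pow]
  have : Module.Flat (MvPolynomial (Fin n) k) (Localization.AtPrime m) :=
    IsLocalization.flat _ m.primeCompl
  exact ker_baseChange_le_range_baseChange
    (IsLocalization.map_units _ (⟨_, hj⟩ ^ t : m.primeCompl)) ht

end PDGModule

theorem proposition5p4_general {k : Type u} [Field k] {n N : ℕ} (hN : N ≠ 0)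
    {M : Type v} [AddCommGroup M] [Module k M] [Module (MvPolynomial (Fin n) k) M]
    [IsScalarTower k (MvPolynomial (Fin n) k) M] [Module.Projective (MvPolynomial (Fin n) k) M]
    (D : PDGModule k n N M) (hfirst : FiniteDimensional k (NHomology N 1 D.d))
    (hlast : FiniteDimensional k (NHomology N (N - 1) D.d))
    (m : Ideal (MvPolynomial (Fin n) k)) [m.IsMaximal]
    (hne : m ≠ Ideal.span (Set.range MvPolynomial.X)) :
    (∀ s ≤ N, Subsingleton (NHomology N s (D.d.baseChange (MvPolynomial (Fin n) k ⧸ m)))) ∧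
    IsContractibleNDifferential (P := Localization.AtPrime m ⊗[MvPolynomial (Fin n) k] M) N
      (D.d.baseChange (Localization.AtPrime m)) := by
  obtain ⟨j, hj⟩ := exists_X_notMem hne
  obtain ⟨q, rfl⟩ := Nat.exists_eq_succ_of_ne_zero hN
  have d_pow : D.d.baseChange (Localization.AtPrime m) ^ (q + 1) = 0 := by
    rw [← LinearMap.baseChange_pow, D.d_pow, LinearMap.baseChange_zero]
  have hcontr : IsContractibleNDifferential (q + 1) (D.d.baseChange (Localization.AtPrime m)) :=
    isContractibleNDifferential_of_globalDimensionLE.{u, v} (P := Localization.AtPrime m ⊗ M)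
      ((globalDimensionLE_mvPolynomial k n).isLocalization m.primeCompl) d_pow
      (by simpa using D.ker_baseChange_pow_le_range hj hfirst)
      (by simpa using D.ker_baseChange_pow_le_range hj hlast)
  exact ⟨fun _ hs => (hcontr.baseChange_quotient_of_localization m).subsingleton_NHomology hs,
    hcontr⟩

theorem proposition5p4 (p : ℕ) [Fact p.Prime] (k : Type u) [Field k] [CharP k p] (n : ℕ)
    (M : Type v) [AddCommGroup M] [Module k M] [Module (MvPolynomial (Fin n) k) M]
    [IsScalarTower k (MvPolynomial (Fin n) k) M]
    (D : PDGModule k n p M) (hfree : D.IsFree)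
    (hfg : Module.Finite (MvPolynomial (Fin n) k) M)
    (hfin : ∀ s : ℕ, 1 ≤ s → s ≤ p - 1 → FiniteDimensional k (NHomology p s D.d))
    (m : Ideal (MvPolynomial (Fin n) k)) [hm : m.IsMaximal]
    (hne : m ≠ Ideal.span (Set.range (MvPolynomial.X : Fin n → MvPolynomial (Fin n) k))) :
    (∀ s : ℕ, 1 ≤ s → s ≤ p - 1 →
      Subsingleton (NHomology p s (D.d.baseChange (MvPolynomial (Fin n) k ⧸ m)))) ∧
    IsContractibleNDifferential (P := Localization.AtPrime m ⊗[MvPolynomial (Fin n) k] M) p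
      (D.d.baseChange (Localization.AtPrime m)) := by
  have hp := (Fact.out : p.Prime).two_le
  have := hfree.projective
  exact (proposition5p4_general (by omega) D (hfin 1 le_rfl (by omega))
    (hfin (p - 1) (by omega) le_rfl) m hne).imp_left fun h s _ hs => h s (by omega)
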